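/- Let $T$ be a (nondegenerate) tetrahedron in $\mathbb{R}^3$, and suppose that, for a suitable numbering $V_1,V_2,V_3,V_4$ of its vertices, its edge lengths $d_{ij}=|V_iV_j|$ satisfy one of the following, where different letters denote different lengths: - type (g): $(d_{12},d_{13},d_{14},d_{23},d_{24},d_{34})=(a,b,c,c,b,a)$; - type (p): $(d_{12},d_{13},d_{14},d_{23},d_{24},d_{34})=(a,c,b,b,d,a)$; - type (w): $(d_{12},d_{13},d_{14},d_{23},d_{24},d_{34})=(b,a,c,d,a,e)$; - type (y): $(d_{12},d_{13},d_{14},d_{23},d_{24},d_{34})=(a,b,c,d,e,f)$. Then $T$ does not tile space face-to-face. That is, there is no collection of tetrahedra, each the image of $T$ under an isometry of $\mathbb{R}^3$ (reflections allowed), that covers $\mathbb{R}^3$ and in which any two distinct tetrahedra have disjoint interiors and meet in a common face (the empty set, a vertex, an edge or a triangular face) of both. -/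

import Mathlib

/-- Euclidean three-space. -/
abbrev Space3 : Type := EuclideanSpace ℝ (Fin 3)

/-- A (nondegenerate) tetrahedron in three-space with labelled vertices: four affinely independent
points. -/
abbrev Tetrahedron : Type := Affine.Simplex ℝ Space3 3

namespace Tetrahedron

/-- The solid tetrahedron: the convex hull of its four vertices. -/
def body (T : Tetrahedron) : Set Space3 := convexHull ℝ (Set.range T.points)

/-- `F` is a face of `T` of some dimension: the empty set, a vertex, an edge, a triangular face, or
the whole solid. These are the convex hulls of the sets of vertices. -/
def IsFace (T : Tetrahedron) (F : Set Space3) : Prop :=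
  ∃ I : Set (Fin 4), F = convexHull ℝ (T.points '' I)

/-- `S` is a copy of `T` under an isometry of space. The isometry need not preserve orientation,
so mirror images are copies. -/
def IsCopy (T S : Tetrahedron) : Prop :=
  ∃ g : Space3 ≃ᵃⁱ[ℝ] Space3, ∀ i, S.points i = g (T.points i)

/-- `𝒯` is a face-to-face tiling of space by copies of `T`: the tiles are copies of `T`, they
cover space, distinct tiles have disjoint interiors, and distinct tiles meet in a common face
(which may be empty). Since interiors are disjoint, no solid occurs twice with its vertices
labelled in different ways. -/
structure IsFaceToFaceTiling (T : Tetrahedron) (𝒯 : Set Tetrahedron) : Prop where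
  copies : ∀ S ∈ 𝒯, T.IsCopy S
  covers : ⋃ S ∈ 𝒯, S.body = Set.univ
  disjoint_interiors : ∀ S ∈ 𝒯, ∀ S' ∈ 𝒯, S ≠ S' → Disjoint (interior S.body) (interior S'.body)
  face_to_face : ∀ S ∈ 𝒯, ∀ S' ∈ 𝒯, S ≠ S' →
    S.IsFace (S.body ∩ S'.body) ∧ S'.IsFace (S.body ∩ S'.body)

/-- `T` tiles space face-to-face. -/
def TilesFaceToFace (T : Tetrahedron) : Prop :=
  ∃ 𝒯 : Set Tetrahedron, T.IsFaceToFaceTiling 𝒯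

/-- For a suitable numbering `V₁, V₂, V₃, V₄` of the vertices of `T`, the lengths of the edges
`V₁V₂, V₁V₃, V₁V₄, V₂V₃, V₂V₄, V₃V₄` are the given numbers. -/
def HasEdgeLengths (T : Tetrahedron) (d₁₂ d₁₃ d₁₄ d₂₃ d₂₄ d₃₄ : ℝ) : Prop :=
  ∃ σ : Equiv.Perm (Fin 4),
    dist (T.points (σ 0)) (T.points (σ 1)) = d₁₂ ∧
    dist (T.points (σ 0)) (T.points (σ 2)) = d₁₃ ∧
    dist (T.points (σ 0)) (T.points (σ 3)) = d₁₄ ∧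
    dist (T.points (σ 1)) (T.points (σ 2)) = d₂₃ ∧
    dist (T.points (σ 1)) (T.points (σ 3)) = d₂₄ ∧
    dist (T.points (σ 2)) (T.points (σ 3)) = d₃₄

/-- Type (g): opposite edges are equal, with three distinct lengths. -/
def IsTypeG (T : Tetrahedron) : Prop :=
  ∃ a b c : ℝ, [a, b, c].Nodup ∧ T.HasEdgeLengths a b c c b a

/-- Type (p): two pairs of opposite edges are equal, with four distinct lengths in all. -/
def IsTypeP (T : Tetrahedron) : Prop :=
  ∃ a b c d : ℝ, [a, b, c, d].Nodup ∧ T.HasEdgeLengths a c b b d a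

/-- Type (w): one pair of opposite edges is equal, with five distinct lengths in all. -/
def IsTypeW (T : Tetrahedron) : Prop :=
  ∃ a b c d e : ℝ, [a, b, c, d, e].Nodup ∧ T.HasEdgeLengths b a c d a e

/-- Type (y): all six edge lengths are distinct. -/
def IsTypeY (T : Tetrahedron) : Prop :=
  ∃ a b c d e f : ℝ, [a, b, c, d, e, f].Nodup ∧ T.HasEdgeLengths a b c d e f

end Tetrahedron

/-!
Two tiles sharing a facet have the same edge lengths on it. Since the faces of `T` are scalene, this
determines the remaining lengths, so the neighbour of a tile across a facet is its mirror image.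
Hence around each edge the group generated by the reflections in the two facets maps tiles to tiles,
and a mirror of this group cannot cut a tile. This forces every dihedral angle to be `π / n`.

It remains to see that such a Coxeter tetrahedron has an isosceles face. Let `g i` be the gradients
of the barycentric coordinates. The nonnegative numbers `-⟪g i, g j⟫`, placed as conductances on the
edges of the tetrahedron, form a connected electrical network whose effective resistances are the
squared edge lengths. As the cosine of an acute angle `π / n` is at least `1 / 2`, the edges of
nonzero conductance contain no triangle, and they form a 4-cycle only if all conductances on it are
equal. A symmetry of the network that interchanges two vertices makes a face isosceles, which
excludes the cycle; for a star and for a path, a short list of possible angles shows that two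
conductances agree, and again two adjacent edges have the same length.
-/

open scoped RealInnerProductSpace
open Equiv Real InnerProductGeometry

/-- Any three of the points `p i` of a metric space span a scalene triangle. For the vertices of a
tetrahedron this is what the types (g), (p), (w) and (y) have in common. -/
def HasScaleneFaces {ι X : Type*} [Dist X] (p : ι → X) : Prop :=
  ∀ ⦃i j k⦄, i ≠ j → i ≠ k → j ≠ k → dist (p i) (p j) ≠ dist (p i) (p k)

theorem eq_or_eq_or_eq_or_eq_of_nodup {i j k l : Fin 4} (h : [i, j, k, l].Nodup) (x : Fin 4) :
    x = i ∨ x = j ∨ x = k ∨ x = l := by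
  decide +revert

theorem exists_nodup_of_ne {i j : Fin 4} (h : i ≠ j) : ∃ k l, [i, j, k, l].Nodup := by
  decide +revert

theorem opposite_pair_eq {i j k l a b c d : Fin 4} (h : [i, j, k, l].Nodup)
    (h' : [a, b, c, d].Nodup) (hab : s(a, b) = s(i, j)) : s(c, d) = s(k, l) := by
  have hc := eq_or_eq_or_eq_or_eq_of_nodup h c
  have hd := eq_or_eq_or_eq_or_eq_of_nodup h d
  simp only [List.nodup_cons, List.mem_cons, Sym2.eq_iff] at *
  grind

theorem exists_perm_eq_comp_of_image_eq {ι X : Type*} [Finite ι] {p q : ι → X}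
    (hp : p.Injective) {s t : Set ι} (h : p '' s = q '' t) :
    ∃ ρ : Perm ι, ∀ j ∈ s, q (ρ j) = p j := by
  have hex : ∀ j : s, ∃ k, q k = p j := fun j => by
    obtain ⟨k, -, hk⟩ := h ▸ Set.mem_image_of_mem p j.2
    exact ⟨k, hk⟩
  choose f hf using hex
  have hinj : f.Injective := fun j k hjk => Subtype.ext (hp (by rw [← hf j, ← hf k, hjk]))
  obtain ⟨ρ, hρ⟩ := Equiv.Perm.exists_extending_pair Subtype.val f Subtype.val_injective hinj
  exact ⟨ρ, fun j hj => by rw [hρ ⟨j, hj⟩, hf]⟩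

section Scalene

variable {X : Type*} [PseudoMetricSpace X] {p : Fin 4 → X}

theorem HasScaleneFaces.eq_or_eq_of_dist_eq (hp : HasScaleneFaces p) {i j k l a b : Fin 4}
    (h : [i, j, k, l].Nodup) (hab : a ≠ b) (hd : dist (p a) (p b) = dist (p i) (p j)) :
    s(a, b) = s(i, j) ∨ s(a, b) = s(k, l) := by
  have hij : i ≠ j := by grind
  have hi : ∀ x, x ≠ i → x ≠ j → dist (p i) (p x) ≠ dist (p i) (p j) := fun x hxi hxj =>
    hp hxi.symm hij hxj
  have hj : ∀ x, x ≠ i → x ≠ j → dist (p j) (p x) ≠ dist (p i) (p j) := fun x hxi hxj => by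
    rw [dist_comm (p i)]; exact hp hxj.symm hij.symm hxi
  have hd' := (dist_comm (p b) (p a)).trans hd
  have ha := eq_or_eq_or_eq_or_eq_of_nodup h a
  have hb := eq_or_eq_or_eq_or_eq_of_nodup h b
  clear hp
  simp only [List.nodup_cons, List.mem_cons, Sym2.eq_iff] at *
  grind

theorem HasScaleneFaces.dist_perm_eq (hp : HasScaleneFaces p) {ρ : Perm (Fin 4)} {i : Fin 4}
    (h : ∀ j k, j ≠ i → k ≠ i → dist (p (ρ j)) (p (ρ k)) = dist (p j) (p k)) (j k : Fin 4) :
    dist (p (ρ j)) (p (ρ k)) = dist (p j) (p k) := by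
  have dist_eq : ∀ {a b c d}, s(a, b) = s(c, d) → dist (p a) (p b) = dist (p c) (p d) := by
    intro a b c d hs
    rcases Sym2.eq_iff.1 hs with ⟨rfl, rfl⟩ | ⟨rfl, rfl⟩
    exacts [rfl, dist_comm _ _]
  have edge : ∀ k, k ≠ i → dist (p (ρ i)) (p (ρ k)) = dist (p i) (p k) := by
    intro k hk
    obtain ⟨l, m, hn⟩ := exists_nodup_of_ne hk.symm
    have hn' : [l, m, i, k].Nodup := by grind
    have hρ : [ρ l, ρ m, ρ i, ρ k].Nodup := hn'.map ρ.injective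
    have hlm : dist (p (ρ l)) (p (ρ m)) = dist (p l) (p m) := h l m (by grind) (by grind)
    rcases hp.eq_or_eq_of_dist_eq hn' (by grind) hlm with hs | hs
    · exact dist_eq (opposite_pair_eq hn' hρ hs)
    · rw [dist_eq (opposite_pair_eq hn hρ hs), ← hlm, dist_eq hs]
  by_cases hj : j = i <;> by_cases hk : k = i
  · simp [hj, hk]
  · rw [hj, edge k hk]
  · rw [hk, dist_comm, edge j hj, dist_comm]
  · exact h j k hj hk

end Scalene

/-! ### Gradients of barycentric coordinates -/

section Gradient

variable {ι V : Type*} [NormedAddCommGroup V] [InnerProductSpace ℝ V] [FiniteDimensional ℝ V]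
  (b : AffineBasis ι ℝ V)

/-- The gradient of the `i`-th barycentric coordinate: a normal of the facet opposite to the
vertex `i`, pointing to the side of that vertex. -/
noncomputable def coordGrad (i : ι) : V :=
  (InnerProductSpace.toDual ℝ V).symm (LinearMap.toContinuousLinearMap (b.coord i).linear)

theorem inner_coordGrad_sub (i : ι) (x y : V) :
    ⟪coordGrad b i, x - y⟫ = b.coord i x - b.coord i y := by
  rw [coordGrad, InnerProductSpace.toDual_symm_apply]
  exact (b.coord i).linearMap_vsub x y

theorem inner_coordGrad_vertex_sub [DecidableEq ι] (i j k : ι) :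
    ⟪coordGrad b i, b j - b k⟫ = (if i = j then 1 else 0) - (if i = k then 1 else 0) := by
  rw [inner_coordGrad_sub, b.coord_apply, b.coord_apply]

theorem coordGrad_ne_zero [Nontrivial ι] (i : ι) : coordGrad b i ≠ 0 := by
  classical
  intro h
  obtain ⟨j, hj⟩ := exists_ne i
  simpa [h, hj.symm] using inner_coordGrad_vertex_sub b i i j

theorem sum_coordGrad [Fintype ι] : ∑ i, coordGrad b i = 0 := by
  refine ext_inner_right ℝ fun v => ?_
  have h : ∀ i, ⟪coordGrad b i, v⟫ = b.coord i v - b.coord i 0 := fun i => by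
    rw [← inner_coordGrad_sub, sub_zero]
  simp only [sum_inner, h, Finset.sum_sub_distrib, b.sum_coord_apply_eq_one, sub_self,
    inner_zero_left]

theorem sum_inner_coordGrad_smul_sub [Fintype ι] (v c : V) :
    ∑ i, ⟪coordGrad b i, v⟫ • (b i - c) = v := by
  have h : ∀ i, ⟪coordGrad b i, v⟫ = b.coord i v - b.coord i 0 := fun i => by
    rw [← inner_coordGrad_sub, sub_zero]
  simp only [h, sub_smul, smul_sub, Finset.sum_sub_distrib, ← Finset.sum_smul,
    b.linear_combination_coord_eq_self, b.sum_coord_apply_eq_one, sub_self, sub_zero]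

theorem eq_of_inner_vertex_sub_eq {u v : V} (k : ι)
    (h : ∀ j, ⟪u, b j - b k⟫ = ⟪v, b j - b k⟫) : u = v := by
  have := b.finite
  have := Fintype.ofFinite ι
  refine ext_inner_right ℝ fun x => ?_
  rw [← sum_inner_coordGrad_smul_sub b x (b k)]
  simp only [inner_sum, real_inner_smul_right, h]

theorem eq_smul_coordGrad {i j : ι} (hji : j ≠ i) {u : V}
    (h : ∀ k, k ≠ i → ⟪u, b k - b j⟫ = 0) : u = ⟪u, b i - b j⟫ • coordGrad b i := by
  classical
  refine eq_of_inner_vertex_sub_eq b j fun k => ?_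
  rw [real_inner_smul_left, inner_coordGrad_vertex_sub, if_neg hji.symm]
  by_cases hk : k = i
  · simp [hk]
  · simp [h k hk, Ne.symm hk]

end Gradient

section Reflection

variable {V : Type*} [NormedAddCommGroup V] [InnerProductSpace ℝ V]

/-- The reflection in the hyperplane orthogonal to `v`; it is the identity for `v = 0`. -/
noncomputable def hyperplaneReflection (v : V) : V ≃ₗᵢ[ℝ] V := (ℝ ∙ v)ᗮ.reflection

theorem hyperplaneReflection_apply (v x : V) :
    hyperplaneReflection v x = x - (2 * (⟪v, x⟫ / ‖v‖ ^ 2)) • v := by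
  rw [hyperplaneReflection, Submodule.reflection_orthogonal_apply,
    Submodule.reflection_singleton_apply, neg_sub, two_smul, two_mul, add_smul]
  rfl

theorem hyperplaneReflection_smul {t : ℝ} (ht : t ≠ 0) (v : V) :
    hyperplaneReflection (t • v) = hyperplaneReflection v := by
  simp only [hyperplaneReflection, Submodule.span_singleton_smul_eq ht.isUnit]

theorem hyperplaneReflection_apply_of_inner_eq_zero {v x : V} (h : ⟪v, x⟫ = 0) :
    hyperplaneReflection v x = x := by
  rw [hyperplaneReflection_apply, h, zero_div, mul_zero, zero_smul, sub_zero]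

theorem hyperplaneReflection_map (L : V ≃ₗᵢ[ℝ] V) (v : V) :
    hyperplaneReflection (L v) = L * hyperplaneReflection v * L⁻¹ := by
  ext x
  have hx : L (L⁻¹ x) = x := L.apply_symm_apply x
  simp only [LinearIsometryEquiv.coe_mul, Function.comp_apply, hyperplaneReflection_apply, map_sub,
    map_smul, L.norm_map, hx]
  rw [← L.inner_map_map v, hx]

end Reflection

section MirrorImage

variable {ι V : Type*} [NormedAddCommGroup V] [InnerProductSpace ℝ V] [FiniteDimensional ℝ V]
  (b : AffineBasis ι ℝ V)

theorem sub_eq_hyperplaneReflection_of_dist_eq {i j : ι} (hji : j ≠ i) {x : V} (hx : x ≠ b i)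
    (h : ∀ k, k ≠ i → dist x (b k) = dist (b i) (b k)) :
    x - b j = hyperplaneReflection (coordGrad b i) (b i - b j) := by
  have hperp : ∀ k, k ≠ i → ⟪b i - x, b k - b j⟫ = 0 := fun k hk => by
    rw [real_inner_comm]
    exact EuclideanGeometry.inner_vsub_vsub_of_dist_eq_of_dist_eq (h j hji) (h k hk)
  have hgrad := eq_smul_coordGrad b hji hperp
  have ht : ⟪b i - x, b i - b j⟫ ≠ 0 := fun h0 => by
    rw [h0, zero_smul, sub_eq_zero] at hgrad
    exact hx hgrad.symm
  have hnorm : ‖b i - b j‖ = ‖x - b j‖ := by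
    rw [← dist_eq_norm, ← dist_eq_norm, h j hji]
  have hrefl := Submodule.reflection_sub hnorm
  rw [sub_sub_sub_cancel_right, hgrad] at hrefl
  rw [← hrefl]
  exact congrArg (· (b i - b j)) (hyperplaneReflection_smul ht _)

end MirrorImage

section Conductance

variable {ι V : Type*} [NormedAddCommGroup V] [InnerProductSpace ℝ V] [FiniteDimensional ℝ V]
  (b : AffineBasis ι ℝ V)

/-- The negative of the inner product of two coordinate gradients. Regarded as the conductance of
a wire joining the vertices `i` and `j`, it makes the squared distances of the vertices the
effective resistances of the network. -/
noncomputable def conductance (i j : ι) : ℝ := -⟪coordGrad b i, coordGrad b j⟫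

theorem conductance_comm (i j : ι) : conductance b i j = conductance b j i := by
  rw [conductance, conductance, real_inner_comm]

theorem inner_sum_coordGrad_vertex_sub {s : Finset ι} {i j : ι} (hi : i ∈ s)
    (hj : j ∉ s) :
    ⟪∑ k ∈ s, coordGrad b k, b i - b j⟫ = 1 := by
  classical
  simp [sum_inner, inner_coordGrad_vertex_sub, hi, hj]

theorem coordGrad_eq_sum_conductance_smul [Fintype ι] (i : ι) :
    coordGrad b i = ∑ j, conductance b i j • (b i - b j) := by
  conv_lhs => rw [← sum_inner_coordGrad_smul_sub b (coordGrad b i) (b i)]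
  refine Finset.sum_congr rfl fun j _ => ?_
  rw [conductance, real_inner_comm, neg_smul, ← smul_neg, neg_sub]

theorem norm_sq_coordGrad [Fintype ι] [DecidableEq ι] (i : ι) :
    ‖coordGrad b i‖ ^ 2 = ∑ j ∈ Finset.univ.erase i, conductance b i j := by
  have h : ∑ j, ⟪coordGrad b i, coordGrad b j⟫ = 0 := by
    rw [← inner_sum, sum_coordGrad, inner_zero_right]
  rw [← Finset.add_sum_erase _ _ (Finset.mem_univ i), real_inner_self_eq_norm_sq] at h
  simp only [conductance, Finset.sum_neg_distrib]
  linarith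

theorem sum_coordGrad_eq_sum_cut [Fintype ι] [DecidableEq ι] (s : Finset ι) :
    ∑ i ∈ s, coordGrad b i = ∑ i ∈ s, ∑ j ∈ sᶜ, conductance b i j • (b i - b j) := by
  have hanti : ∑ i ∈ s, ∑ j ∈ s, conductance b i j • (b i - b j) = 0 := by
    simp only [smul_sub, Finset.sum_sub_distrib]
    rw [sub_eq_zero, Finset.sum_comm]
    simp only [conductance_comm b]
  rw [← zero_add (∑ i ∈ s, ∑ j ∈ sᶜ, _), ← hanti, ← Finset.sum_add_distrib]
  refine Finset.sum_congr rfl fun i _ => ?_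
  rw [Finset.sum_add_sum_compl, ← coordGrad_eq_sum_conductance_smul]

theorem exists_conductance_ne_zero [Fintype ι] [DecidableEq ι] {s : Finset ι}
    (hs : s.Nonempty) (hs' : sᶜ.Nonempty) : ∃ i ∈ s, ∃ j ∈ sᶜ, conductance b i j ≠ 0 := by
  by_contra! h
  obtain ⟨i, hi⟩ := hs
  obtain ⟨j, hj⟩ := hs'
  have hone := inner_sum_coordGrad_vertex_sub b hi (Finset.mem_compl.1 hj)
  rw [sum_coordGrad_eq_sum_cut, Finset.sum_eq_zero fun m hm => Finset.sum_eq_zero fun n hn => by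
    rw [h m hm n hn, zero_smul], inner_zero_left] at hone
  exact zero_ne_one hone

theorem conductance_mul_dist_sq_of_bridge {s : Finset ι} {i j : ι} (hi : i ∈ s) (hj : j ∉ s)
    (h : ∀ m ∈ s, ∀ n ∉ s, (m, n) ≠ (i, j) → conductance b m n = 0) :
    conductance b i j * dist (b i) (b j) ^ 2 = 1 := by
  classical
  have := b.finite
  have := Fintype.ofFinite ι
  have hsum : ∑ k ∈ s, coordGrad b k = conductance b i j • (b i - b j) := by
    rw [sum_coordGrad_eq_sum_cut, ← Finset.sum_product',
      Finset.sum_eq_single_of_mem (i, j) (by simp [hi, hj]) fun p hp hne => by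
        rw [Finset.mem_product, Finset.mem_compl] at hp
        rw [h p.1 hp.1 p.2 hp.2 hne, zero_smul]]
  rw [← inner_sum_coordGrad_vertex_sub b hi hj, hsum, real_inner_smul_left,
    real_inner_self_eq_norm_sq, dist_eq_norm]

theorem dist_eq_of_conductance_eq {i j k : ι} (hki : k ≠ i) (hkj : k ≠ j)
    (h : ∀ m, m ≠ i → m ≠ j → conductance b i m = conductance b j m) :
    dist (b i) (b k) = dist (b j) (b k) := by
  classical
  have := b.finite
  have := Fintype.ofFinite ι
  by_cases hij : i = j
  · rw [hij]
  set v := coordGrad b i - coordGrad b j with hv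
  have hpair : ∀ x y, ⟪v, b x - b y⟫ = _ := fun x y => by
    rw [hv, inner_sub_left, inner_coordGrad_vertex_sub, inner_coordGrad_vertex_sub]
  have hspan : v = ⟪coordGrad b i, v⟫ • (b i - b j) := by
    conv_lhs => rw [← sum_inner_coordGrad_smul_sub b v (b j)]
    refine Finset.sum_eq_single_of_mem i (Finset.mem_univ i) fun m _ hmi => ?_
    by_cases hmj : m = j
    · rw [hmj, sub_self, smul_zero]
    · have := h m hmi hmj
      rw [conductance_comm b i, conductance_comm b j, conductance, conductance, neg_inj] at this
      rw [hv, inner_sub_right, this, sub_self, zero_smul]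
  have hperp : ⟪v, (b i - b k) + (b j - b k)⟫ = 0 := by
    rw [inner_add_right, hpair, hpair]
    simp [hij, hki.symm, hkj.symm, Ne.symm hij]
  have htwo : ⟪v, b i - b j⟫ ≠ 0 := by
    rw [hpair]; simp [hij, Ne.symm hij]
  rw [hspan, real_inner_smul_left, ← sub_sub_sub_cancel_right (b i) (b j) (b k)] at hperp
  rw [dist_eq_norm, dist_eq_norm, ← real_inner_add_sub_eq_zero_iff, real_inner_comm]
  refine (mul_eq_zero.1 hperp).resolve_left fun h0 => htwo ?_
  rw [hspan, h0, zero_smul, inner_zero_left]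

end Conductance

/-! ### Coxeter simplices -/

section Trigonometry

theorem exists_eq_pi_div_of_sin_mul_sin_nonneg {θ : ℝ} (hθ : 0 < θ) (hθπ : θ < π)
    (h : ∀ n : ℕ, 0 ≤ sin ((n + 1) * θ) * sin (n * θ)) : ∃ n : ℕ, 2 ≤ n ∧ θ = π / n := by
  -- Unless `π` is a multiple of `θ`, it lies strictly between `m * θ` and `(m + 1) * θ`.
  set m := ⌊π / θ⌋₊
  have hle : m * θ ≤ π := (le_div_iff₀ hθ).1 (Nat.floor_le (by positivity))
  have hlt : π < (m + 1) * θ := (div_lt_iff₀ hθ).1 (Nat.lt_floor_add_one _)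
  have hm : 0 < m := Nat.floor_pos.2 ((one_le_div hθ).2 hθπ.le)
  rcases hle.eq_or_lt with heq | hlt'
  · refine ⟨m, ?_, by rw [← heq]; field_simp⟩
    by_contra! hm2
    rw [show m = 1 by omega, Nat.cast_one, one_mul] at heq
    exact hθπ.ne heq
  · have hpos : 0 < sin (m * θ) := sin_pos_of_pos_of_lt_pi (by positivity) hlt'
    have hneg : 0 < sin ((m + 1) * θ - π) := sin_pos_of_pos_of_lt_pi (by linarith) (by linarith)
    rw [sin_sub_pi] at hneg
    nlinarith [h m]

theorem cos_sq_pi_div_cases {n : ℕ} (hn : 3 ≤ n) :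
    (n = 3 ∧ cos (π / n) ^ 2 = 1 / 4) ∨ (n = 4 ∧ cos (π / n) ^ 2 = 1 / 2) ∨
      (n = 5 ∧ cos (π / n) ^ 2 = (3 + √5) / 8) ∨ 3 / 4 ≤ cos (π / n) ^ 2 := by
  obtain rfl | rfl | rfl | hn : n = 3 ∨ n = 4 ∨ n = 5 ∨ 6 ≤ n := by omega
  · left; norm_num
  · right; left; norm_num [div_pow]
  · right; right; left
    refine ⟨rfl, ?_⟩
    rw [Nat.cast_ofNat, cos_pi_div_five]
    linear_combination Real.sq_sqrt (show (0 : ℝ) ≤ 5 by norm_num) / 16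
  · right; right; right
    have hle : cos (π / 6) ≤ cos (π / n) :=
      cos_le_cos_of_nonneg_of_le_pi (by positivity) (by linarith [pi_pos])
        (by gcongr; exact_mod_cast hn)
    calc (3 / 4 : ℝ) = cos (π / 6) ^ 2 := by norm_num [div_pow]
      _ ≤ cos (π / n) ^ 2 := by gcongr; norm_num; positivity

theorem two_lt_sqrt_five : 2 < √5 := (lt_sqrt (by norm_num)).2 (by norm_num)

theorem sqrt_five_lt : √5 < 9 / 4 := (sqrt_lt' (by norm_num)).2 (by norm_num)

theorem eq_or_eq_or_eq_of_cos_sq_add_eq_one {p q r : ℕ} (hp : 3 ≤ p) (hq : 3 ≤ q) (hr : 3 ≤ r)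
    (h : cos (π / p) ^ 2 + cos (π / q) ^ 2 + cos (π / r) ^ 2 = 1) : p = q ∨ p = r ∨ q = r := by
  have hlt := two_lt_sqrt_five
  have hgt := sqrt_five_lt
  rcases cos_sq_pi_div_cases hp with ⟨rfl, hp'⟩ | ⟨rfl, hp'⟩ | ⟨rfl, hp'⟩ | hp' <;>
  rcases cos_sq_pi_div_cases hq with ⟨rfl, hq'⟩ | ⟨rfl, hq'⟩ | ⟨rfl, hq'⟩ | hq' <;>
  rcases cos_sq_pi_div_cases hr with ⟨rfl, hr'⟩ | ⟨rfl, hr'⟩ | ⟨rfl, hr'⟩ | hr' <;>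
  first | simp; done | (exfalso; linarith)

theorem sin_sq_pi_div_cases {n : ℕ} (hn : 3 ≤ n) :
    n = 4 ∨ sin (π / n) ^ 2 = 3 / 4 ∨
      sin (π / n) ^ 2 < 3 / 8 ∧ (1 / 3 < sin (π / n) ^ 2 ∨ sin (π / n) ^ 2 ≤ 1 / 4) := by
  have hlt := two_lt_sqrt_five
  have hgt := sqrt_five_lt
  rw [sin_sq]
  rcases cos_sq_pi_div_cases hn with ⟨-, h⟩ | ⟨h, -⟩ | ⟨-, h⟩ | h
  · exact Or.inr (Or.inl (by rw [h]; norm_num))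
  · exact Or.inl h
  · exact Or.inr (Or.inr ⟨by linarith, Or.inl (by linarith)⟩)
  · exact Or.inr (Or.inr ⟨by linarith, Or.inr (by linarith)⟩)

theorem eq_four_or_eq_four_of_cos_sq_eq {p q r : ℕ} (hp : 3 ≤ p) (hq : 3 ≤ q) (hr : 3 ≤ r)
    (h : cos (π / q) ^ 2 = sin (π / p) ^ 2 * sin (π / r) ^ 2) : p = 4 ∨ r = 4 := by
  have hcos : cos (π / q) ^ 2 = 1 / 4 ∨ cos (π / q) ^ 2 = 1 / 2 ∨ 5 / 8 < cos (π / q) ^ 2 := by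
    have hlt := two_lt_sqrt_five
    rcases cos_sq_pi_div_cases hq with ⟨-, h⟩ | ⟨-, h⟩ | ⟨-, h⟩ | h
    exacts [Or.inl h, Or.inr (Or.inl h), Or.inr (Or.inr (by linarith)),
      Or.inr (Or.inr (by linarith))]
  by_contra! hne
  rcases (sin_sq_pi_div_cases hp).resolve_left hne.1 with hp' | ⟨hp', hp''⟩ <;>
    rcases (sin_sq_pi_div_cases hr).resolve_left hne.2 with hr' | ⟨hr', hr''⟩
  · rw [hp', hr'] at h
    norm_num [h] at hcos
  · rw [hp'] at h
    rcases hcos with hcos | hcos | hcos <;> rcases hr'' with hr'' | hr'' <;> linarith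
  · rw [hr'] at h
    rcases hcos with hcos | hcos | hcos <;> rcases hp'' with hp'' | hp'' <;> linarith
  · have : sin (π / p) ^ 2 * sin (π / r) ^ 2 ≤ 3 / 8 * (3 / 8) := by gcongr
    rcases hcos with hcos | hcos | hcos <;> linarith

end Trigonometry

section Rotation

variable {V : Type*} [NormedAddCommGroup V] [InnerProductSpace ℝ V]

theorem hyperplaneReflection_rotation_mem (G : Subgroup (V ≃ₗᵢ[ℝ] V)) {u v : V} {θ : ℝ}
    (hθ : sin θ ≠ 0) (hu : ‖u‖ = 1) (hv : ‖v‖ = 1) (huv : ⟪u, v⟫ = -cos θ)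
    (hGu : hyperplaneReflection u ∈ G) (hGv : hyperplaneReflection v ∈ G) (n : ℕ) :
    hyperplaneReflection (sin ((n + 1) * θ) • u + sin (n * θ) • v) ∈ G := by
  induction n generalizing u v with
  | zero => simpa [hyperplaneReflection_smul hθ] using hGu
  | succ n ih =>
    have hreflect : hyperplaneReflection u (sin ((n + 1) * θ) • v + sin (n * θ) • u) =
        sin ((n + 1 + 1) * θ) • u + sin ((n + 1) * θ) • v := by
      have hsin : sin ((n + 1 + 1) * θ) = 2 * cos θ * sin ((n + 1) * θ) - sin (n * θ) := by
        rw [add_one_mul ((n : ℝ) + 1), show n * θ = (n + 1) * θ - θ by ring, sin_add, sin_sub]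
        ring
      rw [hyperplaneReflection_apply, inner_add_right, real_inner_smul_right,
        real_inner_smul_right, huv, real_inner_self_eq_norm_sq, hu, hsin]
      module
    rw [Nat.cast_succ, ← hreflect, hyperplaneReflection_map]
    exact G.mul_mem (G.mul_mem hGu (ih hv hu (by rw [real_inner_comm, huv]) hGv hGu))
      (G.inv_mem hGu)

end Rotation

section DihedralAngle

variable {ι V : Type*} [NormedAddCommGroup V] [InnerProductSpace ℝ V] [FiniteDimensional ℝ V]
  (b : AffineBasis ι ℝ V)

/-- The dihedral angle between the facets opposite to the vertices `i` and `j`. -/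
noncomputable def dihedralAngle (i j : ι) : ℝ := π - angle (coordGrad b i) (coordGrad b j)

theorem conductance_eq_cos_mul (i j : ι) :
    conductance b i j = cos (dihedralAngle b i j) * (‖coordGrad b i‖ * ‖coordGrad b j‖) := by
  rw [dihedralAngle, cos_pi_sub, neg_mul, cos_angle_mul_norm_mul_norm, conductance]

theorem dihedralAngle_mem_Ioo {i j k : ι} (hij : i ≠ j) (hik : i ≠ k) (hjk : j ≠ k) :
    dihedralAngle b i j ∈ Set.Ioo 0 π := by
  classical
  have hpar : ∀ r : ℝ, coordGrad b j ≠ r • coordGrad b i := fun r hr => by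
    have h := inner_coordGrad_vertex_sub b j j k
    rw [hr, real_inner_smul_left, inner_coordGrad_vertex_sub] at h
    simp [hij, hik, hjk] at h
  rw [Set.mem_Ioo, dihedralAngle, sub_pos, sub_lt_self_iff]
  refine ⟨(angle_le_pi _ _).lt_of_ne fun h => ?_, (angle_nonneg _ _).lt_of_ne fun h => ?_⟩
  · obtain ⟨-, r, -, hr⟩ := angle_eq_pi_iff.1 h
    exact hpar r hr
  · obtain ⟨-, r, -, hr⟩ := angle_eq_zero_iff.1 h.symm
    exact hpar r hr

/-- A Coxeter simplex: every dihedral angle is `π / n` for an integer `n ≥ 2`. -/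
def IsCoxeter : Prop :=
  ∀ i j, i ≠ j → ∃ n : ℕ, 2 ≤ n ∧ dihedralAngle b i j = π / n

variable {b}

theorem IsCoxeter.conductance_nonneg (h : IsCoxeter b) {i j : ι} (hij : i ≠ j) :
    0 ≤ conductance b i j := by
  obtain ⟨n, hn, hangle⟩ := h i j hij
  have hn' : (2 : ℝ) ≤ n := by exact_mod_cast hn
  have hcos : 0 ≤ cos (π / n) := cos_nonneg_of_neg_pi_div_two_le_of_le
    (by linarith [pi_pos, show 0 ≤ π / n by positivity]) (by gcongr)
  rw [conductance_eq_cos_mul, hangle]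
  positivity

theorem IsCoxeter.exists_conductance_sq_eq (h : IsCoxeter b) {i j : ι} (hij : i ≠ j)
    (hw : 0 < conductance b i j) : ∃ n : ℕ, 3 ≤ n ∧
      conductance b i j ^ 2 = cos (π / n) ^ 2 * (‖coordGrad b i‖ ^ 2 * ‖coordGrad b j‖ ^ 2) := by
  obtain ⟨n, hn, hangle⟩ := h i j hij
  rw [conductance_eq_cos_mul, hangle] at hw ⊢
  refine ⟨n, hn.lt_of_ne fun h2 => ?_, by rw [mul_pow, mul_pow]⟩
  rw [← h2, Nat.cast_ofNat, cos_pi_div_two, zero_mul] at hw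
  exact hw.false

theorem IsCoxeter.norm_sq_mul_norm_sq_le (h : IsCoxeter b) {i j : ι} (hij : i ≠ j)
    (hw : 0 < conductance b i j) :
    ‖coordGrad b i‖ ^ 2 * ‖coordGrad b j‖ ^ 2 ≤ 4 * conductance b i j ^ 2 := by
  obtain ⟨n, hn, hsq⟩ := h.exists_conductance_sq_eq hij hw
  have hcos : 1 / 4 ≤ cos (π / n) ^ 2 := by
    rcases cos_sq_pi_div_cases hn with ⟨-, h⟩ | ⟨-, h⟩ | ⟨-, h⟩ | h <;>
      linarith [Real.sqrt_nonneg 5]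
  rw [hsq]
  nlinarith [mul_nonneg (sq_nonneg ‖coordGrad b i‖) (sq_nonneg ‖coordGrad b j‖)]

end DihedralAngle

section CoxeterTetrahedron

variable {V : Type*} [NormedAddCommGroup V] [InnerProductSpace ℝ V] [FiniteDimensional ℝ V]
  {b : AffineBasis (Fin 4) ℝ V} {i j k l : Fin 4}

theorem norm_sq_coordGrad_of_nodup (h : [i, j, k, l].Nodup) :
    ‖coordGrad b i‖ ^ 2 = conductance b i j + conductance b i k + conductance b i l := by
  have herase : Finset.univ.erase i = {j, k, l} := by
    ext x
    have := eq_or_eq_or_eq_or_eq_of_nodup h x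
    simp only [Finset.mem_erase, Finset.mem_univ, Finset.mem_insert, Finset.mem_singleton]
    grind
  rw [norm_sq_coordGrad, herase, Finset.sum_insert (by grind), Finset.sum_insert (by grind),
    Finset.sum_singleton, add_assoc]

-- Both squared norms are at least `2 * conductance b i j`, and their product is at most the square
-- of this number, because positive conductances are at least half the product of the norms.
theorem IsCoxeter.add_eq_of_conductance_le (hc : IsCoxeter b) (h : [i, j, k, l].Nodup)
    (hw : 0 < conductance b i j) {p q : Fin 4} (hp : p = k ∨ p = l) (hq : q = k ∨ q = l)
    (hip : conductance b i j ≤ conductance b i p) (hjq : conductance b i j ≤ conductance b j q) :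
    conductance b i k + conductance b i l = conductance b i j ∧
      conductance b j k + conductance b j l = conductance b i j := by
  have hle := hc.norm_sq_mul_norm_sq_le (show i ≠ j by grind) hw
  rw [norm_sq_coordGrad_of_nodup h,
    norm_sq_coordGrad_of_nodup (show [j, i, k, l].Nodup by grind), conductance_comm b j i] at hle
  have hik := hc.conductance_nonneg (show i ≠ k by grind)
  have hil := hc.conductance_nonneg (show i ≠ l by grind)
  have hjk := hc.conductance_nonneg (show j ≠ k by grind)
  have hjl := hc.conductance_nonneg (show j ≠ l by grind)
  have hi : conductance b i j ≤ conductance b i k + conductance b i l := by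
    rcases hp with rfl | rfl <;> linarith
  have hj : conductance b i j ≤ conductance b j k + conductance b j l := by
    rcases hq with rfl | rfl <;> linarith
  constructor <;> nlinarith

theorem IsCoxeter.not_triangle_of_le (hc : IsCoxeter b) (h : [i, j, k, l].Nodup)
    (hij : 0 < conductance b i j) (hik : conductance b i j ≤ conductance b i k)
    (hjk : conductance b i j ≤ conductance b j k) : False := by
  obtain ⟨hi, hj⟩ := hc.add_eq_of_conductance_le h hij (.inl rfl) (.inl rfl) hik hjk
  have hil := hc.conductance_nonneg (show i ≠ l by grind)
  have hk := (hc.add_eq_of_conductance_le (show [i, k, j, l].Nodup by grind) (by linarith)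
    (.inl rfl) (.inl rfl) (by linarith) (by rw [conductance_comm b k]; linarith)).2
  have hl := norm_sq_coordGrad_of_nodup (b := b) (show [l, i, j, k].Nodup by grind)
  rw [conductance_comm b l, conductance_comm b l, conductance_comm b l] at hl
  rw [conductance_comm b k j] at hk
  have hpos : 0 < ‖coordGrad b l‖ ^ 2 := by
    have := coordGrad_ne_zero b l
    positivity
  linarith

theorem IsCoxeter.not_triangle (hc : IsCoxeter b) (h : [i, j, k, l].Nodup)
    (hij : 0 < conductance b i j) (hik : 0 < conductance b i k) (hjk : 0 < conductance b j k) :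
    False := by
  have hi : [j, k, i, l].Nodup := by grind
  have hj : [i, k, j, l].Nodup := by grind
  have hji := conductance_comm b j i
  have hki := conductance_comm b k i
  have hkj := conductance_comm b k j
  rcases le_total (conductance b i j) (conductance b i k) with h₁ | h₁ <;>
    rcases le_total (conductance b i j) (conductance b j k) with h₂ | h₂ <;>
    rcases le_total (conductance b i k) (conductance b j k) with h₃ | h₃
  all_goals first
    | exact hc.not_triangle_of_le h hij (by linarith) (by linarith)
    | exact hc.not_triangle_of_le hi hjk (by linarith) (by linarith)
    | exact hc.not_triangle_of_le hj hik (by linarith) (by linarith)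

theorem IsCoxeter.conductance_eq_zero (hc : IsCoxeter b) (h : [i, j, k, l].Nodup)
    (hij : 0 < conductance b i j) (hjk : 0 < conductance b j k) : conductance b i k = 0 := by
  by_contra hne
  exact hc.not_triangle h hij
    ((hc.conductance_nonneg (show i ≠ k by grind)).lt_of_ne' hne) hjk

theorem IsCoxeter.not_cycle_of_le (hc : IsCoxeter b) (hs : HasScaleneFaces b)
    (h : [i, j, k, l].Nodup) (hij : 0 < conductance b i j)
    (hjk : conductance b i j ≤ conductance b j k) (hkl : conductance b i j ≤ conductance b k l)
    (hli : conductance b i j ≤ conductance b l i) : False := by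
  have hji := conductance_comm b j i
  have hkj := conductance_comm b k j
  have hil := conductance_comm b i l
  have hik := hc.conductance_eq_zero h hij (by linarith)
  have hjl := hc.conductance_eq_zero (show [j, k, l, i].Nodup by grind) (by linarith)
    (by linarith)
  obtain ⟨hi, hj⟩ := hc.add_eq_of_conductance_le h hij (.inr rfl) (.inl rfl) (by linarith) hjk
  have hk := (hc.add_eq_of_conductance_le (show [j, k, i, l].Nodup by grind) (by linarith)
    (.inl rfl) (.inr rfl) (by linarith) (by linarith)).2
  rw [conductance_comm b k i] at hk
  refine hs (show j ≠ i by grind) (show j ≠ k by grind) (show i ≠ k by grind) ?_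
  rw [dist_comm (b j), dist_comm (b j)]
  refine dist_eq_of_conductance_eq b (by grind) (by grind) fun m hmi hmk => ?_
  obtain rfl | rfl : m = j ∨ m = l := by
    have := eq_or_eq_or_eq_or_eq_of_nodup h m
    grind
  all_goals linarith

theorem IsCoxeter.not_cycle (hc : IsCoxeter b) (hs : HasScaleneFaces b)
    (h : [i, j, k, l].Nodup) (hij : 0 < conductance b i j) (hjk : 0 < conductance b j k)
    (hkl : 0 < conductance b k l) (hli : 0 < conductance b l i) : False := by
  have hj : [j, k, l, i].Nodup := by grind
  have hk : [k, l, i, j].Nodup := by grind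
  have hl : [l, i, j, k].Nodup := by grind
  rcases le_total (conductance b i j) (conductance b j k) with h₁ | h₁ <;>
    rcases le_total (conductance b k l) (conductance b l i) with h₂ | h₂ <;>
    rcases le_total (min (conductance b i j) (conductance b j k))
      (min (conductance b k l) (conductance b l i)) with h₃ | h₃ <;>
    simp only [h₁, h₂, min_eq_left, min_eq_right] at h₃
  all_goals first
    | exact hc.not_cycle_of_le hs h hij (by linarith) (by linarith) (by linarith)
    | exact hc.not_cycle_of_le hs hj hjk (by linarith) (by linarith) (by linarith)
    | exact hc.not_cycle_of_le hs hk hkl (by linarith) (by linarith) (by linarith)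
    | exact hc.not_cycle_of_le hs hl hli (by linarith) (by linarith) (by linarith)

theorem IsCoxeter.exists_conductance_eq_of_leaf (hc : IsCoxeter b) (h : [i, j, k, l].Nodup)
    (hij : 0 < conductance b i j) (hik : conductance b i k = 0) (hil : conductance b i l = 0) :
    ∃ n : ℕ, 3 ≤ n ∧ conductance b i j = cos (π / n) ^ 2 * ‖coordGrad b j‖ ^ 2 := by
  obtain ⟨n, hn, hsq⟩ := hc.exists_conductance_sq_eq (show i ≠ j by grind) hij
  refine ⟨n, hn, mul_left_cancel₀ hij.ne' ?_⟩
  rw [norm_sq_coordGrad_of_nodup h, hik, hil] at hsq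
  linear_combination hsq

theorem HasScaleneFaces.ne_of_leaves (hs : HasScaleneFaces b) (h : [i, j, k, l].Nodup)
    (hjl : conductance b j l = 0) (hkl : conductance b k l = 0) :
    conductance b j i ≠ conductance b k i := fun heq => by
  refine hs (show i ≠ j by grind) (show i ≠ k by grind) (show j ≠ k by grind) ?_
  rw [dist_comm (b i), dist_comm (b i)]
  refine dist_eq_of_conductance_eq b (by grind) (by grind) fun m hmj hmk => ?_
  obtain rfl | rfl : m = i ∨ m = l := by
    have := eq_or_eq_or_eq_or_eq_of_nodup h m
    grind
  · exact heq
  · rw [hjl, hkl]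

theorem IsCoxeter.not_star (hc : IsCoxeter b) (hs : HasScaleneFaces b) (h : [i, j, k, l].Nodup)
    (hij : 0 < conductance b i j) (hik : 0 < conductance b i k) (hil : 0 < conductance b i l) :
    False := by
  have hk : [i, k, j, l].Nodup := by grind
  have hl : [i, l, j, k].Nodup := by grind
  have hnorm := norm_sq_coordGrad_of_nodup (b := b) h
  rw [conductance_comm] at hij hik hil
  have hjk := hc.conductance_eq_zero (show [j, i, k, l].Nodup by grind) hij
    (by rwa [conductance_comm])
  have hjl := hc.conductance_eq_zero (show [j, i, l, k].Nodup by grind) hij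
    (by rwa [conductance_comm])
  have hkl := hc.conductance_eq_zero (show [k, i, l, j].Nodup by grind) hik
    (by rwa [conductance_comm])
  have hkj := (conductance_comm b k j).trans hjk
  have hlj := (conductance_comm b l j).trans hjl
  have hlk := (conductance_comm b l k).trans hkl
  obtain ⟨p, hp, hp'⟩ := hc.exists_conductance_eq_of_leaf (show [j, i, k, l].Nodup by grind)
    hij hjk hjl
  obtain ⟨q, hq, hq'⟩ := hc.exists_conductance_eq_of_leaf (show [k, i, j, l].Nodup by grind)
    hik hkj hkl
  obtain ⟨r, hr, hr'⟩ := hc.exists_conductance_eq_of_leaf (show [l, i, j, k].Nodup by grind)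
    hil hlj hlk
  have hsum : cos (π / p) ^ 2 + cos (π / q) ^ 2 + cos (π / r) ^ 2 = 1 := by
    refine mul_right_cancel₀ (pow_ne_zero 2 (norm_ne_zero_iff.2 (coordGrad_ne_zero b i))) ?_
    rw [add_mul, add_mul, ← hp', ← hq', ← hr', one_mul, hnorm, conductance_comm b i,
      conductance_comm b i, conductance_comm b i]
  rcases eq_or_eq_or_eq_of_cos_sq_add_eq_one hp hq hr hsum with rfl | rfl | rfl
  · exact hs.ne_of_leaves h hjl hkl (hp'.trans hq'.symm)
  · exact hs.ne_of_leaves (show [i, j, l, k].Nodup by grind) hjk hlk (hp'.trans hr'.symm)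
  · exact hs.ne_of_leaves (show [i, k, l, j].Nodup by grind) hkj hlj (hq'.trans hr'.symm)

theorem HasScaleneFaces.ne_of_path (hs : HasScaleneFaces b) (h : [i, j, k, l].Nodup)
    (hik : conductance b i k = 0) (hil : conductance b i l = 0) (hjl : conductance b j l = 0) :
    conductance b i j ≠ conductance b j k := fun heq => by
  have hij : conductance b i j * dist (b i) (b j) ^ 2 = 1 :=
    conductance_mul_dist_sq_of_bridge b (s := {i}) (by simp) (by grind) fun m hm n hn hne => by
      have := eq_or_eq_or_eq_or_eq_of_nodup h n
      grind
  have hjk : conductance b j k * dist (b j) (b k) ^ 2 = 1 :=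
    conductance_mul_dist_sq_of_bridge b (s := {i, j}) (by simp) (by grind) fun m hm n hn hne => by
      have := eq_or_eq_or_eq_or_eq_of_nodup h n
      grind
  have hsq : dist (b i) (b j) ^ 2 = dist (b j) (b k) ^ 2 := by
    refine mul_left_cancel₀ (left_ne_zero_of_mul_eq_one hij) ?_
    rw [hij, heq, hjk]
  refine hs (show j ≠ i by grind) (show j ≠ k by grind) (show i ≠ k by grind) ?_
  rw [dist_comm (b j) (b i)]
  exact (sq_eq_sq₀ dist_nonneg dist_nonneg).1 hsq

theorem IsCoxeter.not_path (hc : IsCoxeter b) (hs : HasScaleneFaces b) (h : [i, j, k, l].Nodup)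
    (hij : 0 < conductance b i j) (hjk : 0 < conductance b j k) (hkl : 0 < conductance b k l) :
    False := by
  have hik := hc.conductance_eq_zero h hij hjk
  have hjl := hc.conductance_eq_zero (show [j, k, l, i].Nodup by grind) hjk hkl
  have hil : conductance b l i = 0 := by
    by_contra hne
    exact hc.not_cycle hs h hij hjk hkl
      ((hc.conductance_nonneg (show l ≠ i by grind)).lt_of_ne' hne)
  have hji := conductance_comm b j i
  have hkj := conductance_comm b k j
  have hlk := conductance_comm b l k
  have hki := (conductance_comm b k i).trans hik
  have hlj := (conductance_comm b l j).trans hjl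
  have hil' := (conductance_comm b i l).trans hil
  obtain ⟨p, hp, hp'⟩ := hc.exists_conductance_eq_of_leaf h hij hik hil'
  obtain ⟨q, hq, hq'⟩ := hc.exists_conductance_sq_eq (show j ≠ k by grind) hjk
  obtain ⟨r, hr, hr'⟩ := hc.exists_conductance_eq_of_leaf (show [l, k, j, i].Nodup by grind)
    (by rwa [hlk]) hlj hil
  have hj := norm_sq_coordGrad_of_nodup (b := b) (show [j, i, k, l].Nodup by grind)
  have hk := norm_sq_coordGrad_of_nodup (b := b) (show [k, j, l, i].Nodup by grind)
  have hsinp : conductance b j k = sin (π / p) ^ 2 * ‖coordGrad b j‖ ^ 2 := by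
    rw [sin_sq]; linarith
  have hsinr : conductance b j k = sin (π / r) ^ 2 * ‖coordGrad b k‖ ^ 2 := by
    rw [sin_sq]; linarith
  have hcos : cos (π / q) ^ 2 = sin (π / p) ^ 2 * sin (π / r) ^ 2 := by
    have hj0 := norm_ne_zero_iff.2 (coordGrad_ne_zero b j)
    have hk0 := norm_ne_zero_iff.2 (coordGrad_ne_zero b k)
    refine mul_right_cancel₀ (mul_ne_zero (pow_ne_zero 2 hj0) (pow_ne_zero 2 hk0)) ?_
    rw [← hq', mul_mul_mul_comm, ← hsinp, ← hsinr, sq]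
  have hfour : cos (π / (4 : ℕ)) ^ 2 = 1 / 2 := by norm_num [div_pow]
  rcases eq_four_or_eq_four_of_cos_sq_eq hp hq hr hcos with rfl | rfl
  · exact hs.ne_of_path h hik hil' hjl (by rw [hfour] at hp'; linarith)
  · exact hs.ne_of_path (show [l, k, j, i].Nodup by grind) hlj hil hki
      (by rw [hfour] at hr'; linarith)

theorem IsCoxeter.exists_conductance_pos (hc : IsCoxeter b) {s : Finset (Fin 4)}
    (hs : s.Nonempty) (hs' : sᶜ.Nonempty) : ∃ i ∈ s, ∃ j ∉ s, 0 < conductance b i j := by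
  obtain ⟨i, hi, j, hj, hne⟩ := exists_conductance_ne_zero b hs hs'
  have hj' := Finset.mem_compl.1 hj
  exact ⟨i, hi, j, hj', (hc.conductance_nonneg (by grind)).lt_of_ne' hne⟩

theorem IsCoxeter.not_adjacent_edges (hc : IsCoxeter b) (hs : HasScaleneFaces b)
    (h : [i, j, k, l].Nodup) (hij : 0 < conductance b i j) (hjk : 0 < conductance b j k) :
    False := by
  obtain ⟨x, hx, y, hy, hxy⟩ := hc.exists_conductance_pos (s := {i, j, k}) (by simp)
    ⟨l, by simp only [Finset.mem_compl]; grind⟩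
  obtain rfl : y = l := by
    have := eq_or_eq_or_eq_or_eq_of_nodup h y
    grind
  simp only [Finset.mem_insert, Finset.mem_singleton] at hx
  rcases hx with rfl | rfl | rfl
  · exact hc.not_path hs (show [y, x, j, k].Nodup by grind) (by rwa [conductance_comm]) hij hjk
  · exact hc.not_star hs (show [x, i, k, y].Nodup by grind) (by rwa [conductance_comm]) hjk hxy
  · exact hc.not_path hs h hij hjk hxy

theorem IsCoxeter.not_hasScaleneFaces (hc : IsCoxeter b) : ¬ HasScaleneFaces b := fun hs => by
  obtain ⟨i, hi, j, hj, hij⟩ := hc.exists_conductance_pos (s := {0}) (by simp) ⟨1, by simp⟩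
  obtain ⟨k, l, h⟩ := exists_nodup_of_ne (show i ≠ j by grind)
  obtain ⟨x, hx, y, hy, hxy⟩ := hc.exists_conductance_pos (s := {i, j}) (by simp)
    ⟨k, by simp only [Finset.mem_compl]; grind⟩
  obtain ⟨z, hz⟩ : ∃ z, [i, j, y, z].Nodup := by
    rcases eq_or_eq_or_eq_or_eq_of_nodup h y with rfl | rfl | rfl | rfl
    exacts [by grind, by grind, ⟨l, h⟩, ⟨k, by grind⟩]
  simp only [Finset.mem_insert, Finset.mem_singleton] at hx
  rcases hx with rfl | rfl
  · exact hc.not_adjacent_edges hs (show [j, x, y, z].Nodup by grind)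
      (by rwa [conductance_comm]) hxy
  · exact hc.not_adjacent_edges hs hz hij hxy

end CoxeterTetrahedron

/-! ### Tetrahedra and their images -/

section ConvexHull

variable {ι E : Type*} [AddCommGroup E] [Module ℝ E] (b : AffineBasis ι ℝ E)

theorem coord_eq_zero_of_mem_convexHull_image {s : Set ι} {x : E}
    (hx : x ∈ convexHull ℝ (b '' s)) {i : ι} (hi : i ∉ s) : b.coord i x = 0 := by
  have hconvex : Convex ℝ (b.coord i ⁻¹' {0}) := (convex_singleton 0).affine_preimage _
  refine convexHull_min ?_ hconvex hx
  rintro _ ⟨j, hj, rfl⟩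
  exact b.coord_apply_ne (ne_of_mem_of_not_mem hj hi).symm

theorem exists_coord_eq [Fintype ι] {w : ι → ℝ} (hw : ∑ i, w i = 1) : ∃ x, ∀ i, b.coord i x = w i :=
  ⟨Finset.univ.affineCombination ℝ b w,
    fun i => b.coord_apply_combination_of_mem (Finset.mem_univ i) hw⟩

theorem exists_coord_eq_div_sum [Fintype ι] {w : ι → ℝ} (hw : ∑ i, w i ≠ 0) :
    ∃ x, ∀ i, b.coord i x = w i / ∑ j, w j :=
  exists_coord_eq b (by rw [← Finset.sum_div, div_self hw])

theorem vertex_mem_extremePoints [Finite ι] (i : ι) :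
    b i ∈ (convexHull ℝ (Set.range b)).extremePoints ℝ := by
  classical
  have := Fintype.ofFinite ι
  refine mem_extremePoints_iff_left.2 ⟨subset_convexHull ℝ _ ⟨i, rfl⟩, fun x hx y hy hxy => ?_⟩
  rw [b.convexHull_eq_nonneg_coord] at hx hy
  obtain ⟨s, t, hs, ht, hst, hi⟩ := hxy
  have hzero : ∀ j, j ≠ i → b.coord j x = 0 := fun j hj => by
    have hcoord := Convex.combo_affine_apply (f := b.coord j) (x := x) (y := y) hst
    rw [hi, b.coord_apply_ne hj, smul_eq_mul, smul_eq_mul] at hcoord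
    nlinarith [hx j, hy j, mul_nonneg hs.le (hx j), mul_nonneg ht.le (hy j)]
  refine b.ext_elem fun j => ?_
  by_cases hj : j = i
  · rw [hj, b.coord_apply_eq, ← Fintype.sum_eq_single i hzero, b.sum_coord_apply_eq_one]
  · rw [hzero j hj, b.coord_apply_ne hj]

theorem extremePoints_convexHull_image [Finite ι] (s : Set ι) :
    (convexHull ℝ (b '' s)).extremePoints ℝ = b '' s := by
  refine extremePoints_convexHull_subset.antisymm ?_
  rintro _ ⟨i, hi, rfl⟩
  exact inter_extremePoints_subset_extremePoints_of_subset
    (convexHull_mono (Set.image_subset_range _ _))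
    ⟨subset_convexHull ℝ _ ⟨i, hi, rfl⟩, vertex_mem_extremePoints b i⟩

end ConvexHull

theorem locallyFinite_of_pairwise_le_dist {ι X : Type*} [MetricSpace X] [ProperSpace X]
    {A : ι → Set X} {c : ι → X} {r R : ℝ} (hr : 0 < r)
    (hc : Pairwise fun i j => r ≤ dist (c i) (c j))
    (hA : ∀ i, A i ⊆ Metric.closedBall (c i) R) : LocallyFinite A := by
  let : TopologicalSpace ι := ⊥
  have : DiscreteTopology ι := ⟨rfl⟩
  have hfinite : ∀ x ρ, (c ⁻¹' Metric.closedBall x ρ).Finite := fun x ρ =>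
    ((Metric.isClosedEmbedding_of_pairwise_le_dist hr hc).isCompact_preimage
      (isCompact_closedBall x ρ)).finite_of_discrete
  refine fun x => ⟨Metric.closedBall x 1, Metric.closedBall_mem_nhds x one_pos,
    (hfinite x (R + 1)).subset fun i ⟨y, hy, hyx⟩ => ?_⟩
  rw [Set.mem_preimage, Metric.mem_closedBall]
  have hyc := Metric.mem_closedBall'.1 (hA i hy)
  exact (dist_triangle _ y _).trans (add_le_add hyc (Metric.mem_closedBall.1 hyx))

section IsometryAbout

variable {V : Type*} [NormedAddCommGroup V] [InnerProductSpace ℝ V]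

/-- The isometry with fixed point `p` and linear part `L`. -/
noncomputable def isometryAbout (p : V) (L : V ≃ₗᵢ[ℝ] V) : V ≃ᵃⁱ[ℝ] V :=
  (AffineIsometryEquiv.vaddConst ℝ p).symm.trans
    (L.toAffineIsometryEquiv.trans (AffineIsometryEquiv.vaddConst ℝ p))

theorem isometryAbout_apply (p : V) (L : V ≃ₗᵢ[ℝ] V) (x : V) :
    isometryAbout p L x = L (x - p) + p := rfl

theorem isometryAbout_apply_self (p : V) (L : V ≃ₗᵢ[ℝ] V) : isometryAbout p L p = p := by
  rw [isometryAbout_apply, sub_self, map_zero, zero_add]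

theorem isometryAbout_mul_apply (p : V) (L M : V ≃ₗᵢ[ℝ] V) (x : V) :
    isometryAbout p (L * M) x = isometryAbout p L (isometryAbout p M x) := by
  simp only [isometryAbout_apply, add_sub_cancel_right, LinearIsometryEquiv.coe_mul,
    Function.comp_apply]

theorem isometryAbout_hyperplaneReflection_eq_self_iff {p u x : V} :
    isometryAbout p (hyperplaneReflection u) x = x ↔ ⟪u, x - p⟫ = 0 := by
  rw [isometryAbout_apply, ← eq_sub_iff_add_eq]
  refine ⟨fun h => ?_, hyperplaneReflection_apply_of_inner_eq_zero⟩
  exact Submodule.mem_orthogonal_singleton_iff_inner_right.1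
    ((Submodule.reflection_eq_self_iff _).1 h)

end IsometryAbout

namespace Tetrahedron

/-- The vertices of a tetrahedron as an affine basis of space. -/
noncomputable def basis (T : Tetrahedron) : AffineBasis (Fin 4) ℝ Space3 :=
  ⟨T.points, T.independent,
    (T.independent.affineSpan_eq_top_iff_card_eq_finrank_add_one).2 (by simp)⟩

@[simp]
theorem basis_apply (T : Tetrahedron) (i : Fin 4) : T.basis i = T.points i := rfl

theorem mem_body {T : Tetrahedron} {x : Space3} : x ∈ T.body ↔ ∀ i, 0 ≤ T.basis.coord i x := by
  change x ∈ convexHull ℝ (Set.range T.basis) ↔ _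
  rw [T.basis.convexHull_eq_nonneg_coord]
  rfl

theorem mem_interior_body {T : Tetrahedron} {x : Space3} :
    x ∈ interior T.body ↔ ∀ i, 0 < T.basis.coord i x := by
  change x ∈ interior (convexHull ℝ (Set.range T.basis)) ↔ _
  rw [T.basis.interior_convexHull]
  rfl

theorem isCompact_body (T : Tetrahedron) : IsCompact T.body :=
  (Set.finite_range T.points).isCompact_convexHull (𝕜 := ℝ)

theorem interior_body_nonempty (T : Tetrahedron) : (interior T.body).Nonempty :=
  ⟨_, T.basis.centroid_mem_interior_convexHull⟩

theorem body_eq_of_points_eq {S T : Tetrahedron} {σ : Perm (Fin 4)}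
    (h : ∀ i, S.points i = T.points (σ i)) : S.body = T.body := by
  rw [body, body, show S.points = T.points ∘ σ from funext h, σ.surjective.range_comp]

/-- The image of a tetrahedron under an isometry, with the vertices numbered accordingly. -/
noncomputable def image (T : Tetrahedron) (g : Space3 ≃ᵃⁱ[ℝ] Space3) : Tetrahedron :=
  T.map g.toAffineEquiv.toAffineMap g.injective

@[simp]
theorem image_points (T : Tetrahedron) (g : Space3 ≃ᵃⁱ[ℝ] Space3) (i : Fin 4) :
    (T.image g).points i = g (T.points i) := rfl

theorem body_image (T : Tetrahedron) (g : Space3 ≃ᵃⁱ[ℝ] Space3) :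
    (T.image g).body = g '' T.body := by
  have hpoints : (T.image g).points = g ∘ T.points := rfl
  rw [body, body, hpoints, Set.range_comp]
  exact (AffineMap.image_convexHull g.toAffineEquiv.toAffineMap (Set.range T.points)).symm

theorem interior_body_image (T : Tetrahedron) (g : Space3 ≃ᵃⁱ[ℝ] Space3) :
    interior (T.image g).body = g '' interior T.body := by
  rw [body_image]
  exact (g.toHomeomorph.image_interior T.body).symm

theorem isCopy_iff {S T : Tetrahedron} : T.IsCopy S ↔ ∃ g, S = T.image g :=
  exists_congr fun _ => ⟨fun h => Affine.Simplex.ext h, fun h i => by rw [h, image_points]⟩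

theorem IsCopy.dist_eq {S T : Tetrahedron} (h : T.IsCopy S) (i j : Fin 4) :
    dist (S.points i) (S.points j) = dist (T.points i) (T.points j) := by
  obtain ⟨g, hg⟩ := h
  rw [hg, hg, g.dist_map]

theorem coordGrad_image_isometryAbout (T : Tetrahedron) (p : Space3) (L : Space3 ≃ₗᵢ[ℝ] Space3)
    (i : Fin 4) :
    coordGrad (T.image (isometryAbout p L)).basis i = L (coordGrad T.basis i) := by
  refine eq_of_inner_vertex_sub_eq (T.image (isometryAbout p L)).basis i fun j => ?_
  have hsub : (T.image (isometryAbout p L)).basis j - (T.image (isometryAbout p L)).basis i =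
      L (T.basis j - T.basis i) := by
    simp only [basis_apply, image_points, isometryAbout_apply, add_sub_add_right_eq_sub,
      ← map_sub, sub_sub_sub_cancel_right]
  rw [inner_coordGrad_vertex_sub, hsub, L.inner_map_map, inner_coordGrad_vertex_sub]

namespace IsFaceToFaceTiling

variable {T : Tetrahedron} {𝒯 : Set Tetrahedron}

theorem locallyFinite (h : T.IsFaceToFaceTiling 𝒯) : LocallyFinite fun S : 𝒯 => S.1.body := by
  obtain ⟨c, hc⟩ := T.interior_body_nonempty
  obtain ⟨r, hr, hball⟩ := Metric.isOpen_iff.1 isOpen_interior c hc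
  obtain ⟨R, hR⟩ := T.isCompact_body.isBounded.subset_closedBall c
  choose g hg using fun S : 𝒯 => isCopy_iff.1 (h.copies S S.2)
  have hgball : ∀ S, Metric.ball (g S c) r ⊆ interior S.1.body := fun S => by
    rw [hg S, interior_body_image]
    exact ((g S).toIsometryEquiv.image_ball c r).symm.subset.trans (Set.image_mono hball)
  refine locallyFinite_of_pairwise_le_dist (c := fun S => g S c) (R := R) hr
    (fun S S' hne => ?_) fun S => ?_
  · by_contra! hlt
    refine Set.disjoint_left.1 (h.disjoint_interiors S S.2 S' S'.2 (Subtype.coe_ne_coe.2 hne))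
      (hgball S ?_) (hgball S' (Metric.mem_ball_self hr))
    rwa [Metric.mem_ball, dist_comm]
  · rw [hg S, body_image]
    exact (Set.image_mono hR).trans ((g S).toIsometryEquiv.image_closedBall c R).subset

theorem exists_ne_mem_body (h : T.IsFaceToFaceTiling 𝒯) {S : Tetrahedron} {x : Space3}
    (hx : x ∉ interior S.body) : ∃ S' ∈ 𝒯, S' ≠ S ∧ x ∈ S'.body := by
  by_contra! hnot
  have hclosed : IsClosed (⋃ S' : {S' : 𝒯 // S'.1 ≠ S}, S'.1.1.body) :=
    (h.locallyFinite.comp_injective Subtype.val_injective).isClosed_iUnion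
      fun S' => S'.1.1.isCompact_body.isClosed
  refine hx (interior_maximal (fun y hy => ?_) hclosed.isOpen_compl ?_)
  · obtain ⟨S', hS', hyS'⟩ := Set.mem_iUnion₂.1 (h.covers.symm ▸ Set.mem_univ y)
    by_contra hyS
    exact hy (Set.mem_iUnion.2 ⟨⟨⟨S', hS'⟩, fun heq => hyS (heq ▸ hyS')⟩, hyS'⟩)
  · rw [Set.mem_compl_iff, Set.mem_iUnion]
    rintro ⟨⟨⟨S', hS'⟩, hne⟩, hxS'⟩
    exact hnot S' hS' hne hxS'

end IsFaceToFaceTiling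

/-! ### Reflected tiles -/

/-- The tiles of a collection with their vertices renumbered in all possible ways. -/
def relabelings (𝒯 : Set Tetrahedron) : Set Tetrahedron :=
  {P | ∃ S ∈ 𝒯, ∃ σ : Perm (Fin 4), ∀ i, P.points i = S.points (σ i)}

variable {T P Q : Tetrahedron} {𝒯 : Set Tetrahedron} {i j k l : Fin 4}

theorem extremePoints_face (T : Tetrahedron) (I : Set (Fin 4)) :
    (convexHull ℝ (T.points '' I)).extremePoints ℝ = T.points '' I :=
  extremePoints_convexHull_image T.basis I

theorem exists_mem_facet (T : Tetrahedron) (i : Fin 4) :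
    ∃ x ∈ T.body, x ∉ interior T.body ∧ ∀ j, j ≠ i → T.basis.coord j x ≠ 0 := by
  have hsum : ∑ j, (if j = i then (0 : ℝ) else 1) = 3 := by
    fin_cases i <;> simp [Fin.sum_univ_four] <;> norm_num
  obtain ⟨x, hx⟩ := exists_coord_eq_div_sum T.basis (hsum.trans_ne three_ne_zero)
  rw [hsum] at hx
  refine ⟨x, mem_body.2 fun j => ?_, fun h => ?_, fun j hj => ?_⟩
  · rw [hx]
    split_ifs <;> norm_num
  · simpa [hx] using mem_interior_body.1 h i
  · simp [hx, hj]

namespace IsFaceToFaceTiling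

theorem exists_adjacent (h : T.IsFaceToFaceTiling 𝒯) {S : Tetrahedron} (hS : S ∈ 𝒯)
    (i : Fin 4) : ∃ S' ∈ 𝒯, S' ≠ S ∧ ∃ ρ : Perm (Fin 4),
      ∀ j, j ≠ i → S'.points (ρ j) = S.points j := by
  obtain ⟨x, hxS, hxint, hx⟩ := S.exists_mem_facet i
  obtain ⟨S', hS', hne, hxS'⟩ := h.exists_ne_mem_body hxint
  obtain ⟨⟨I, hI⟩, ⟨J, hJ⟩⟩ := h.face_to_face S hS S' hS' hne.symm
  have hmem : ∀ j, j ≠ i → j ∈ I := fun j hj => by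
    by_contra hjI
    exact hx j hj (coord_eq_zero_of_mem_convexHull_image S.basis (hI ▸ ⟨hxS, hxS'⟩) hjI)
  have hvertices : S.points '' I = S'.points '' J := by
    rw [← extremePoints_face S I, ← extremePoints_face S' J, ← hI, ← hJ]
  obtain ⟨ρ, hρ⟩ := exists_perm_eq_comp_of_image_eq S.independent.injective hvertices
  exact ⟨S', hS', hne, ρ, fun j hj => hρ j (hmem j hj)⟩

theorem exists_adjacent_relabeling (h : T.IsFaceToFaceTiling 𝒯) (hP : P ∈ relabelings 𝒯)
    (i : Fin 4) : ∃ Q ∈ relabelings 𝒯,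
      (∀ j, j ≠ i → Q.points j = P.points j) ∧ Q.points i ≠ P.points i := by
  obtain ⟨S, hS, σ, hσ⟩ := hP
  obtain ⟨S', hS', hne, ρ, hρ⟩ := h.exists_adjacent hS (σ i)
  have hfacet : ∀ j, j ≠ i → S'.points (ρ (σ j)) = P.points j := fun j hj => by
    rw [hρ _ (σ.injective.ne hj), hσ]
  refine ⟨S'.reindex (σ.trans ρ).symm, ⟨S', hS', σ.trans ρ, fun _ => rfl⟩, hfacet, fun hi => ?_⟩
  have hbody : P.body = S'.body := body_eq_of_points_eq (σ := σ.trans ρ) fun j => by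
    by_cases hj : j = i
    · exact hj ▸ hi.symm
    · exact (hfacet j hj).symm
  have hdisjoint := h.disjoint_interiors S' hS' S hS hne
  rw [← body_eq_of_points_eq hσ, hbody, disjoint_self] at hdisjoint
  exact S'.interior_body_nonempty.ne_empty hdisjoint

theorem exists_dist_eq (h : T.IsFaceToFaceTiling 𝒯) (hP : P ∈ relabelings 𝒯) :
    ∃ σ : Perm (Fin 4), ∀ j k,
      dist (P.points j) (P.points k) = dist (T.points (σ j)) (T.points (σ k)) := by
  obtain ⟨S, hS, σ, hσ⟩ := hP
  exact ⟨σ, fun j k => by rw [hσ, hσ, (h.copies S hS).dist_eq]⟩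

theorem hasScaleneFaces (h : T.IsFaceToFaceTiling 𝒯) (hT : HasScaleneFaces T.points)
    (hP : P ∈ relabelings 𝒯) : HasScaleneFaces P.points := by
  obtain ⟨σ, hσ⟩ := h.exists_dist_eq hP
  intro i j k hij hik hjk
  rw [hσ, hσ]
  exact hT (σ.injective.ne hij) (σ.injective.ne hik) (σ.injective.ne hjk)

theorem dist_eq_of_eq_off (h : T.IsFaceToFaceTiling 𝒯) (hT : HasScaleneFaces T.points)
    (hP : P ∈ relabelings 𝒯) (hQ : Q ∈ relabelings 𝒯)
    (hQP : ∀ j, j ≠ i → Q.points j = P.points j) (j k : Fin 4) :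
    dist (Q.points j) (Q.points k) = dist (P.points j) (P.points k) := by
  obtain ⟨σ, hσ⟩ := h.exists_dist_eq hP
  obtain ⟨τ, hτ⟩ := h.exists_dist_eq hQ
  have hρ : ∀ j k, dist (P.points ((τ.trans σ.symm) j)) (P.points ((τ.trans σ.symm) k)) =
      dist (Q.points j) (Q.points k) := fun j k => by
    rw [hσ, hτ, Equiv.trans_apply, Equiv.trans_apply, σ.apply_symm_apply, σ.apply_symm_apply]
  rw [← hρ]
  exact (h.hasScaleneFaces hT hP).dist_perm_eq
    (fun j k hj hk => by rw [hρ, hQP j hj, hQP k hk]) j k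

theorem image_reflection_mem (h : T.IsFaceToFaceTiling 𝒯) (hT : HasScaleneFaces T.points)
    (hP : P ∈ relabelings 𝒯) (hki : k ≠ i) :
    P.image (isometryAbout (P.points k) (hyperplaneReflection (coordGrad P.basis i))) ∈
      relabelings 𝒯 := by
  obtain ⟨Q, hQ, hQP, hne⟩ := h.exists_adjacent_relabeling hP i
  have hdist := h.dist_eq_of_eq_off hT hP hQ hQP
  have hmirror := sub_eq_hyperplaneReflection_of_dist_eq P.basis hki hne fun j hj => by
    rw [basis_apply, basis_apply, ← hdist i j, hQP j hj]
  have himage : ∀ j, (P.image (isometryAbout (P.points k)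
      (hyperplaneReflection (coordGrad P.basis i)))).points j = Q.points j := fun j => by
    rw [image_points]
    by_cases hj : j = i
    · rw [hj, isometryAbout_apply, ← basis_apply, ← basis_apply, ← hmirror, sub_add_cancel]
    · rw [hQP j hj, isometryAbout_hyperplaneReflection_eq_self_iff, ← basis_apply,
        ← basis_apply, inner_coordGrad_vertex_sub, if_neg (Ne.symm hj), if_neg hki.symm,
        sub_zero]
  obtain ⟨S, hS, σ, hσ⟩ := hQ
  exact ⟨S, hS, σ, fun j => (himage j).trans (hσ j)⟩

theorem image_mem_of_mem_closure (h : T.IsFaceToFaceTiling 𝒯) (hT : HasScaleneFaces T.points)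
    (hP : P ∈ relabelings 𝒯) (s : Set (Fin 4)) (hk : k ∉ s) {L : Space3 ≃ₗᵢ[ℝ] Space3}
    (hL : L ∈ Subgroup.closure ((fun i => hyperplaneReflection (coordGrad P.basis i)) '' s)) :
    P.image (isometryAbout (P.points k) L) ∈ relabelings 𝒯 := by
  have step : ∀ M : Space3 ≃ₗᵢ[ℝ] Space3, ∀ i ∈ s,
      P.image (isometryAbout (P.points k) M) ∈ relabelings 𝒯 →
      P.image (isometryAbout (P.points k)
        (M * hyperplaneReflection (coordGrad P.basis i))) ∈ relabelings 𝒯 := fun M i hi hM => by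
    have hmirror := h.image_reflection_mem hT hM (ne_of_mem_of_not_mem hi hk).symm
    rw [coordGrad_image_isometryAbout, hyperplaneReflection_map, image_points,
      isometryAbout_apply_self] at hmirror
    convert hmirror using 1
    refine Affine.Simplex.ext fun j => ?_
    simp only [image_points, ← isometryAbout_mul_apply, inv_mul_cancel_right]
  induction hL using Subgroup.closure_induction_right with
  | one =>
    convert hP using 1
    exact Affine.Simplex.ext fun j => by simp [isometryAbout_apply]
  | mul_right M _ _ hi ih =>
    obtain ⟨i, hi, rfl⟩ := hi
    exact step M i hi ih
  | mul_inv_cancel M _ _ hi ih =>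
    obtain ⟨i, hi, rfl⟩ := hi
    exact step M i hi ih

theorem exists_perm_of_mem_interior (h : T.IsFaceToFaceTiling 𝒯) (hP : P ∈ relabelings 𝒯)
    (hQ : Q ∈ relabelings 𝒯) {x : Space3} (hxP : x ∈ interior P.body)
    (hxQ : x ∈ interior Q.body) : ∃ σ : Perm (Fin 4), ∀ j, Q.points j = P.points (σ j) := by
  obtain ⟨S, hS, σ, hσ⟩ := hP
  obtain ⟨S', hS', τ, hτ⟩ := hQ
  rw [body_eq_of_points_eq hσ] at hxP
  rw [body_eq_of_points_eq hτ] at hxQ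
  obtain rfl : S = S' := by
    by_contra hne
    exact Set.disjoint_left.1 (h.disjoint_interiors S hS S' hS' hne) hxP hxQ
  exact ⟨τ.trans σ.symm, fun j => by simp [hσ, hτ]⟩

end IsFaceToFaceTiling

theorem exists_mem_interior_mul_coord_add_eq_zero (T : Tetrahedron) (hij : i ≠ j) {α β : ℝ}
    (h : α * β < 0) :
    ∃ x ∈ interior T.body, α * T.basis.coord i x + β * T.basis.coord j x = 0 := by
  set w : Fin 4 → ℝ := fun m => if m = i then |β| else if m = j then |α| else 1
  have hw : ∀ m, 0 < w m := fun m => by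
    have hα : α ≠ 0 := left_ne_zero_of_mul h.ne
    have hβ : β ≠ 0 := right_ne_zero_of_mul h.ne
    simp only [w]
    split_ifs <;> positivity
  have hsum : 0 < ∑ m, w m := Finset.sum_pos (fun m _ => hw m) Finset.univ_nonempty
  obtain ⟨x, hx⟩ := exists_coord_eq_div_sum T.basis hsum.ne'
  refine ⟨x, mem_interior_body.2 fun m => by rw [hx]; exact div_pos (hw m) hsum, ?_⟩
  have hbalance : α * |β| + β * |α| = 0 := by
    rcases mul_neg_iff.1 h with ⟨hα, hβ⟩ | ⟨hα, hβ⟩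
    · rw [abs_of_pos hα, abs_of_neg hβ]; ring
    · rw [abs_of_neg hα, abs_of_pos hβ]; ring
  rw [hx, hx, ← mul_div_assoc, ← mul_div_assoc, ← add_div]
  simp only [w, if_pos, if_neg hij.symm, hbalance, zero_div]

namespace IsFaceToFaceTiling

-- If `α * β < 0`, the mirror cuts the interior of the tile, so the reflected tile is the tile
-- itself with the vertices `i` and `j` interchanged, and its faces containing both are isosceles.
theorem mul_nonneg_of_reflection_mem (h : T.IsFaceToFaceTiling 𝒯) (hT : HasScaleneFaces T.points)
    (hP : P ∈ relabelings 𝒯) (hij : i ≠ j) (hki : k ≠ i) (hkj : k ≠ j) {α β : ℝ}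
    (hmem : hyperplaneReflection (α • coordGrad P.basis i + β • coordGrad P.basis j) ∈
      Subgroup.closure ((fun m => hyperplaneReflection (coordGrad P.basis m)) '' {i, j})) :
    0 ≤ α * β := by
  by_contra! hneg
  obtain ⟨x, hx, hx0⟩ := P.exists_mem_interior_mul_coord_add_eq_zero hij hneg
  set u := α • coordGrad P.basis i + β • coordGrad P.basis j with hu
  set g := isometryAbout (P.points k) (hyperplaneReflection u) with hg
  have hcoord : ∀ m n, P.basis.coord m (P.points n) = if m = n then 1 else 0 := P.basis.coord_apply
  have hfix : ∀ y, g y = y ↔ α * P.basis.coord i y + β * P.basis.coord j y = 0 := fun y => by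
    rw [hg, isometryAbout_hyperplaneReflection_eq_self_iff, hu, inner_add_left,
      real_inner_smul_left, real_inner_smul_left, inner_coordGrad_sub, inner_coordGrad_sub,
      hcoord, hcoord, if_neg hki.symm, if_neg hkj.symm, sub_zero, sub_zero]
  obtain ⟨σ, hσ⟩ := h.exists_perm_of_mem_interior hP
    (h.image_mem_of_mem_closure (k := k) hT hP {i, j} (by simp [hki, hkj]) hmem) hx
    (by rw [interior_body_image]; exact ⟨x, hx, (hfix x).2 hx0⟩)
  simp only [image_points, ← hg] at hσ
  have hfixed : ∀ m, σ m = m ↔ α * P.basis.coord i (P.points m) +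
      β * P.basis.coord j (P.points m) = 0 := fun m => by
    rw [← hfix, hσ, P.independent.injective.eq_iff]
  have hσoff : ∀ m, m ≠ i → m ≠ j → σ m = m := fun m hmi hmj => by
    rw [hfixed, hcoord, hcoord, if_neg hmi.symm, if_neg hmj.symm, mul_zero, mul_zero, add_zero]
  have hσi : σ i ≠ i := fun hi => by
    rw [hfixed, hcoord, hcoord, if_pos rfl, if_neg hij.symm, mul_one, mul_zero, add_zero] at hi
    exact left_ne_zero_of_mul hneg.ne hi
  have hσij : σ i = j := by
    by_contra hne
    exact hσi (σ.injective (hσoff _ hσi hne))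
  refine h.hasScaleneFaces hT hP hki hkj hij ?_
  rw [← g.dist_map, hσ, hσ, hσoff k hki hkj, hσij]

theorem isCoxeter (h : T.IsFaceToFaceTiling 𝒯) (hT : HasScaleneFaces T.points)
    (hP : P ∈ relabelings 𝒯) : IsCoxeter P.basis := by
  intro i j hij
  obtain ⟨k, l, hn⟩ := exists_nodup_of_ne hij
  have hki : k ≠ i := by grind
  have hkj : k ≠ j := by grind
  obtain ⟨hpos, hlt⟩ := dihedralAngle_mem_Ioo P.basis hij hki.symm hkj.symm
  set θ := dihedralAngle P.basis i j with hθ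
  have hnorm : ∀ m, 0 < ‖coordGrad P.basis m‖ := fun m => norm_pos_iff.2 (coordGrad_ne_zero _ m)
  set G := Subgroup.closure ((fun m => hyperplaneReflection (coordGrad P.basis m)) '' {i, j})
  have hG : ∀ m ∈ ({i, j} : Set (Fin 4)),
      hyperplaneReflection (‖coordGrad P.basis m‖⁻¹ • coordGrad P.basis m) ∈ G := fun m hm => by
    rw [hyperplaneReflection_smul (inv_ne_zero (hnorm m).ne')]
    exact Subgroup.subset_closure ⟨m, hm, rfl⟩
  have hunit : ∀ m, ‖‖coordGrad P.basis m‖⁻¹ • coordGrad P.basis m‖ = 1 := fun m =>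
    norm_smul_inv_norm (coordGrad_ne_zero _ m)
  have hinner : ⟪‖coordGrad P.basis i‖⁻¹ • coordGrad P.basis i,
      ‖coordGrad P.basis j‖⁻¹ • coordGrad P.basis j⟫ = -cos θ := by
    have hcos := conductance_eq_cos_mul P.basis i j
    rw [conductance, ← hθ, neg_eq_iff_eq_neg] at hcos
    rw [real_inner_smul_left, real_inner_smul_right, hcos]
    field_simp [(hnorm i).ne', (hnorm j).ne']
  refine exists_eq_pi_div_of_sin_mul_sin_nonneg hpos hlt fun n => ?_
  have hmem := hyperplaneReflection_rotation_mem G (sin_pos_of_pos_of_lt_pi hpos hlt).ne'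
    (hunit i) (hunit j) hinner (hG i (by simp)) (hG j (by simp)) n
  rw [smul_smul, smul_smul] at hmem
  have hprod := h.mul_nonneg_of_reflection_mem hT hP hij hki hkj hmem
  rw [mul_mul_mul_comm] at hprod
  exact nonneg_of_mul_nonneg_left hprod (mul_pos (inv_pos.2 (hnorm i)) (inv_pos.2 (hnorm j)))

end IsFaceToFaceTiling

theorem not_tilesFaceToFace_of_hasScaleneFaces (hT : HasScaleneFaces T.points) :
    ¬ T.TilesFaceToFace := by
  rintro ⟨𝒯, h⟩
  obtain ⟨S, hS, -⟩ := Set.mem_iUnion₂.1 (h.covers.symm ▸ Set.mem_univ (0 : Space3))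
  have hS' : S ∈ relabelings 𝒯 := ⟨S, hS, 1, fun _ => rfl⟩
  exact (h.isCoxeter hT hS').not_hasScaleneFaces (h.hasScaleneFaces hT hS')

theorem HasEdgeLengths.hasScaleneFaces {a b c d e f : ℝ} (h : T.HasEdgeLengths a b c d e f)
    (h₁ : [a, b, c].Nodup) (h₂ : [a, d, e].Nodup) (h₃ : [b, d, f].Nodup)
    (h₄ : [c, e, f].Nodup) : HasScaleneFaces T.points := by
  obtain ⟨σ, h₁₂, h₁₃, h₁₄, h₂₃, h₂₄, h₃₄⟩ := h
  have h₂₁ := (dist_comm _ _).trans h₁₂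
  have h₃₁ := (dist_comm _ _).trans h₁₃
  have h₄₁ := (dist_comm _ _).trans h₁₄
  have h₃₂ := (dist_comm _ _).trans h₂₃
  have h₄₂ := (dist_comm _ _).trans h₂₄
  have h₄₃ := (dist_comm _ _).trans h₃₄
  simp only [List.nodup_cons, List.mem_cons, List.not_mem_nil, or_false, not_or] at h₁ h₂ h₃ h₄
  have hσ : HasScaleneFaces (T.points ∘ σ) := by
    intro i j k
    fin_cases i <;> fin_cases j <;> fin_cases k <;>
      simp [h₁₂, h₁₃, h₁₄, h₂₃, h₂₄, h₃₄, h₂₁, h₃₁, h₄₁, h₃₂, h₄₂, h₄₃] <;> grind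
  intro i j k hij hik hjk
  have := hσ (σ.symm.injective.ne hij) (σ.symm.injective.ne hik) (σ.symm.injective.ne hjk)
  simpa using this

end Tetrahedron

theorem theorem5p5 (T : Tetrahedron)
    (hT : T.IsTypeG ∨ T.IsTypeP ∨ T.IsTypeW ∨ T.IsTypeY) :
    ¬ T.TilesFaceToFace := by
  apply T.not_tilesFaceToFace_of_hasScaleneFaces
  rcases hT with ⟨a, b, c, hn, h⟩ | ⟨a, b, c, d, hn, h⟩ | ⟨a, b, c, d, e, hn, h⟩ |
    ⟨a, b, c, d, e, f, hn, h⟩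
  all_goals exact h.hasScaleneFaces (by grind) (by grind) (by grind) (by grind)
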